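/- Let $R$ be a discrete valuation domain of characteristic $0$ whose maximal ideal is $pR$ for some prime number $p$, let $G$ be a finite cyclic $p$-group, and let $M$ be an $R[G]$-lattice, i.e. a finitely generated left $R[G]$-module which is projective as an $R$-module. Then the following are equivalent: (i) $M$ is an $R[G]$-permutation lattice, i.e. there exists a finite left $G$-set $\Omega$ such that $M \cong R[\Omega]$ as $R[G]$-modules; (ii) $H^1(U, \mathrm{res}^G_U(M)) = 0$ for every subgroup $U$ of $G$; (iii) the module of coinvariants $M_U = M/\omega_{R[U]}M$ is $R$-torsion free for every subgroup $U$ of $G$, where $\omega_{R[U]} = \ker(R[U] \to R)$ denotes the augmentation ideal of $R[U]$. -/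

import Mathlib

universe u

open scoped MonoidAlgebra

namespace Representation

/-- An `R[G]`-lattice: a finitely generated left `R[G]`-module which is projective as an
`R`-module. The module is given by the corresponding representation `ρ` of `G`. -/
structure IsLattice {R G M : Type*} [CommRing R] [Group G] [AddCommGroup M] [Module R M]
    (ρ : Representation R G M) : Prop where
  finite : Module.Finite R[G] ρ.asModule
  projective : Module.Projective R M

/-- The module is isomorphic to `R[Ω]` for some finite left `G`-set `Ω`. As `Ω` is finite, its
universe does not matter. -/
def IsPermutation {R G M : Type*} [CommRing R] [Group G] [AddCommGroup M] [Module R M]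
    (ρ : Representation R G M) : Prop :=
  ∃ (Ω : Type) (_ : Finite Ω) (_ : MulAction G Ω),
    Nonempty (ρ.Equiv (Representation.ofMulAction R G Ω))

end Representation

open Polynomial

/-! ### Polynomial congruences modulo p -/

namespace PermutationLattice

/-! (ii) ⇔ (iii): let N be the norm of U and g a generator. N maps M_U to the torsion-free M, and
its kernel on M_U is killed by |U|; so the torsion of M_U is ker N / (g - 1)M, which is also H^1 of
the cyclic group U. (i) ⇒ (iii): the coinvariants of R[Ω] are free on the orbits.

(iii) ⇒ (i) is `exists_basis_forall_apply_mem_range`, by induction on n where |G| = p^n. In the step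
to p^(n+1), let T be the action of a generator, t = T - 1, q = p^n, A = ker(T^q - 1), and N the norm
of the subgroup of order p. Modulo p, T^q - 1 is t^q and N is t^(q(p-1)). As N maps M into A, M/A is
a torsion-free module over R[X]/Φ(X), Φ being the p^(n+1)-th cyclotomic polynomial; this is a
discrete valuation ring with uniformiser X - 1, so lifts m_j of a basis of M/(A + tM) form a basis
of M/A.

Torsion-freeness for T^q makes the T^i N m_j (i < q) independent modulo p
(`dvd_of_normEnd_sum_eq_smul`). Their span L is free over the quotient group ring, and self-duality
of that ring splits A = L ⊕ A' (`exists_complement_of_independent_orbit`). A' inherits (iii), hence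
has a permuted basis; together with the T^i m_j (i < qp) it is a basis of M, by
`dvd_of_sum_add_eq_smul` and Nakayama. -/

theorem _root_.Polynomial.natCast_dvd_of_map_zmod_eq_zero {p : ℕ} {f : ℤ[X]}
    (hf : f.map (Int.castRingHom (ZMod p)) = 0) : (p : ℤ[X]) ∣ f := by
  rw [show (p : ℤ[X]) = C (p : ℤ) by simp, C_dvd_iff_dvd_coeff]
  intro i
  have := congrArg (fun g => coeff g i) hf
  simpa [ZMod.intCast_zmod_eq_zero_iff_dvd] using this

theorem exists_X_pow_sub_one_eq {p : ℕ} (hp : p.Prime) (m : ℕ) :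
    ∃ h : ℤ[X], X ^ p ^ m - 1 = (X - 1) ^ p ^ m + (p : ℤ[X]) * h := by
  have := Fact.mk hp
  have h : (p : ℤ[X]) ∣ X ^ p ^ m - 1 - (X - 1) ^ p ^ m := by
    apply natCast_dvd_of_map_zmod_eq_zero
    simp [sub_pow_char_pow]
  obtain ⟨h, hh⟩ := h
  exact ⟨h, by rw [← hh]; ring⟩

/-- Modulo p the sum is (X^(p^(n+1)) - 1)/(X^(p^n) - 1), a power of X - 1. Evaluating at X = 1 gives
p on the left, so the cofactor of p takes the value 1 there. -/
theorem exists_geom_sum_eq {p : ℕ} (hp : p.Prime) (n : ℕ) :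
    ∃ h : ℤ[X], ∑ i ∈ Finset.range p, (X ^ p ^ n) ^ i =
      (X - 1) ^ (p ^ n * (p - 1)) + (p : ℤ[X]) * (1 + (X - 1) * h) := by
  have := Fact.mk hp
  have h : (p : ℤ[X]) ∣ ∑ i ∈ Finset.range p, (X ^ p ^ n) ^ i - (X - 1) ^ (p ^ n * (p - 1)) := by
    apply natCast_dvd_of_map_zmod_eq_zero
    have h0 : ((X : (ZMod p)[X]) - 1) ^ p ^ n ≠ 0 :=
      pow_ne_zero _ (by simpa using X_sub_C_ne_zero (1 : ZMod p))
    apply mul_right_cancel₀ h0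
    have h1 := geom_sum_mul ((X : (ZMod p)[X]) ^ p ^ n) p
    have h2 : ((X : (ZMod p)[X]) ^ p ^ n - 1) = (X - 1) ^ p ^ n := by simp [sub_pow_char_pow]
    rw [h2, ← pow_mul, ← pow_succ] at h1
    have h3 : ((X : (ZMod p)[X]) ^ p ^ (n + 1) - 1) = (X - 1) ^ p ^ (n + 1) := by
      simp [sub_pow_char_pow]
    rw [h3] at h1
    simp only [Polynomial.map_sub, Polynomial.map_sum, Polynomial.map_pow, map_X,
      Polynomial.map_one, sub_mul, h1, zero_mul, ← pow_add]
    rw [sub_eq_zero]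
    congr 1
    obtain ⟨r, rfl⟩ : ∃ r, p = r + 1 := ⟨p - 1, by have := hp.pos; omega⟩
    simp; ring
  obtain ⟨g, hg⟩ := h
  have h1 : g.eval 1 = 1 := by
    have := congrArg (eval 1) hg
    have hp1 : p - 1 ≠ 0 := by have := hp.two_le; omega
    have hp0 : (p : ℤ) ≠ 0 := by exact_mod_cast hp.ne_zero
    simp [eval_finsetSum, hp1, hp.ne_zero] at this
    tauto
  obtain ⟨h, hh⟩ : (X - C 1 : ℤ[X]) ∣ g - 1 := by
    rw [dvd_iff_isRoot]; simp [h1]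
  refine ⟨h, ?_⟩
  rw [sub_eq_iff_eq_add'] at hg
  rw [hg, sub_eq_iff_eq_add'.mp hh]; simp

/-! ### Nakayama arguments over a local ring -/

section LocalRing

variable {R M : Type*} [CommRing R] [IsLocalRing R] [AddCommGroup M] [Module R M] {p : R}

/-- Iterating M = S + tM gives M = S + t^d M, which lies in S + pM; Nakayama concludes. -/
theorem eq_top_of_sup_range_eq_top [Module.Finite R M] (hp : p ∈ IsLocalRing.maximalIdeal R)
    {S : Submodule R M} {t : Module.End R M} (hS : ∀ x ∈ S, t x ∈ S)
    (h : S ⊔ LinearMap.range t = ⊤) {d : ℕ} (hd : ∀ x, ∃ y, (t ^ d) x = p • y) : S = ⊤ := by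
  have key : ∀ k, ∀ x, ∃ s ∈ S, ∃ y, x = s + (t ^ k) y := by
    intro k
    induction k with
    | zero => exact fun x => ⟨0, S.zero_mem, x, by simp⟩
    | succ k ih =>
      intro x
      obtain ⟨s, hs, _, ⟨y, rfl⟩, rfl⟩ := Submodule.mem_sup.mp (h ▸ Submodule.mem_top : x ∈ _)
      obtain ⟨s', hs', z, rfl⟩ := ih y
      exact ⟨s + t s', S.add_mem hs (hS _ hs'), z, by simp [pow_succ', add_assoc]⟩
  rw [eq_top_iff]
  apply Submodule.le_of_le_smul_of_le_jacobson_bot (I := IsLocalRing.maximalIdeal R)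
    Module.Finite.fg_top (IsLocalRing.maximalIdeal_le_jacobson _)
  intro x _
  obtain ⟨s, hs, y, rfl⟩ := key d x
  obtain ⟨z, hz⟩ := hd y
  rw [hz]
  exact Submodule.add_mem_sup hs (Submodule.smul_mem_smul hp trivial)

/-- Independence modulo p makes R^ι → M injective over the residue field, hence split over R. -/
theorem exists_dual_family [Module.Finite R M] [Module.Free R M]
    (hp : IsLocalRing.maximalIdeal R = Ideal.span {p}) {ι : Type*} [Fintype ι] [DecidableEq ι]
    (v : ι → M) (h : ∀ (c : ι → R) (x : M), ∑ i, c i • v i = p • x → ∀ i, p ∣ c i) :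
    ∃ f : ι → M →ₗ[R] R, ∀ i j, f i (v j) = if i = j then 1 else 0 := by
  obtain ⟨l', hl'⟩ := (IsLocalRing.split_injective_iff_lTensor_residueField_injective
    (Fintype.linearCombination R v)).mpr (by
      rw [injective_iff_map_eq_zero]
      intro x hx
      obtain ⟨c, rfl⟩ := TensorProduct.mk_surjective R (ι → R) (IsLocalRing.ResidueField R)
        Ideal.Quotient.mk_surjective x
      have : Fintype.linearCombination R v c ∈
          LinearMap.ker (TensorProduct.mk R (R ⧸ IsLocalRing.maximalIdeal R) M 1) := by
        rw [LinearMap.mem_ker]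
        exact hx
      rw [LinearMap.ker_tensorProductMk, hp, Submodule.ideal_span_singleton_smul] at this
      obtain ⟨x, -, hx⟩ := this
      choose d hd using h c x (by rw [← Fintype.linearCombination_apply, ← hx]; rfl)
      have hc : c ∈ LinearMap.ker
          (TensorProduct.mk R (R ⧸ IsLocalRing.maximalIdeal R) (ι → R) 1) := by
        rw [LinearMap.ker_tensorProductMk, hp, Submodule.ideal_span_singleton_smul]
        exact ⟨d, trivial, by ext i; simp [hd]⟩
      exact hc)
  refine ⟨fun i => LinearMap.proj i ∘ₗ l', fun i j => ?_⟩
  have := LinearMap.congr_fun hl' (Pi.single j 1)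
  rw [LinearMap.comp_apply, Fintype.linearCombination_apply_single, one_smul] at this
  simp [this, Pi.single_apply]

theorem exists_minimal_generators [Module.Finite R M] (W : Submodule R M)
    (hp : IsLocalRing.maximalIdeal R = Ideal.span {p}) (hW : ∀ x, p • x ∈ W) :
    ∃ (k : ℕ) (m : Fin k → M), Submodule.span R (Set.range m) ⊔ W = ⊤ ∧
      ∀ c : Fin k → R, ∑ j, c j • m j ∈ W → ∀ j, p ∣ c j := by
  have htors : Module.IsTorsionBySet R (M ⧸ W) (IsLocalRing.maximalIdeal R) := by
    rw [hp, Module.isTorsionBySet_span_singleton_iff]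
    intro x
    obtain ⟨x, rfl⟩ := Submodule.mkQ_surjective W x
    rw [← map_smul, Submodule.mkQ_apply, Submodule.Quotient.mk_eq_zero]
    exact hW x
  let := htors.module
  let : Field (R ⧸ IsLocalRing.maximalIdeal R) := Ideal.Quotient.field _
  have : IsScalarTower R (R ⧸ IsLocalRing.maximalIdeal R) (M ⧸ W) := htors.isScalarTower
  have : Module.Finite (R ⧸ IsLocalRing.maximalIdeal R) (M ⧸ W) :=
    Module.Finite.of_restrictScalars_finite R _ _
  let b := Module.finBasis (R ⧸ IsLocalRing.maximalIdeal R) (M ⧸ W)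
  choose m hm using fun j => Submodule.mkQ_surjective W (b j)
  refine ⟨_, m, ?_, fun c hc j => ?_⟩
  · have h1 : Submodule.map W.mkQ (Submodule.span R (Set.range m)) = ⊤ := by
      rw [Submodule.map_span, ← Set.range_comp, show W.mkQ ∘ m = b from funext hm,
        ← Submodule.restrictScalars_span R (R ⧸ IsLocalRing.maximalIdeal R)
          Ideal.Quotient.mk_surjective, b.span_eq, Submodule.restrictScalars_top]
    have := congrArg (Submodule.comap W.mkQ) h1
    rwa [Submodule.comap_map_mkQ, Submodule.comap_top, sup_comm] at this
  · have h1 : ∑ j, Ideal.Quotient.mk (IsLocalRing.maximalIdeal R) (c j) • b j = 0 := by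
      have h2 := (Submodule.Quotient.mk_eq_zero W).mpr hc
      rw [← Submodule.mkQ_apply, map_sum] at h2
      rw [← h2]
      refine Finset.sum_congr rfl fun j _ => ?_
      rw [map_smul, hm]
      exact algebraMap_smul (R ⧸ IsLocalRing.maximalIdeal R) (c j) (b j)
    have := Fintype.linearIndependent_iff.mp b.linearIndependent _ h1 j
    rwa [Ideal.Quotient.eq_zero_iff_mem, hp, Ideal.mem_span_singleton] at this

end LocalRing

end PermutationLattice

/-! ### t-adic expansions modulo A, and equivariant complements -/

namespace PermutationLattice

variable {R M κ : Type*} [CommRing R] [AddCommGroup M] [Module R M] [Fintype κ] {p : R}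

/-- Comparison of t-adic digits in M/A: the constant terms are divisible by p, so their contribution
already lies in A + t^e M and can be dropped; then t is cancelled by `hinj` and the degree falls by
one. -/
theorem dvd_coeff_of_sum_aeval_mem {t : Module.End R M} {A : Submodule R M} {e : ℕ}
    (hinj : ∀ x, t x ∈ A → x ∈ A) (hp : ∀ x, p • x ∈ A ⊔ LinearMap.range (t ^ e)) {m : κ → M}
    (hm : ∀ c : κ → R, ∑ j, c j • m j ∈ A ⊔ LinearMap.range t → ∀ j, p ∣ c j) {d : ℕ}
    (hd : d ≤ e) (f : κ → R[X]) (h : ∑ j, aeval t (f j) (m j) ∈ A ⊔ LinearMap.range (t ^ d)) :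
    ∀ j, ∀ i < d, p ∣ (f j).coeff i := by
  have hmono : ∀ {a b : ℕ}, a ≤ b → A ⊔ LinearMap.range (t ^ b) ≤ A ⊔ LinearMap.range (t ^ a) := by
    intro a b hab
    refine sup_le_sup_left ?_ A
    obtain ⟨c, rfl⟩ := Nat.exists_eq_add_of_le hab
    rintro _ ⟨x, rfl⟩
    exact ⟨(t ^ c) x, by rw [pow_add]; rfl⟩
  induction d generalizing f with
  | zero => intro j i hi; omega
  | succ d ih =>
    have hsum : ∑ j, aeval t (f j) (m j) =
        t (∑ j, aeval t (f j).divX (m j)) + ∑ j, (f j).coeff 0 • m j := by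
      rw [map_sum, ← Finset.sum_add_distrib]
      refine Finset.sum_congr rfl fun j _ => ?_
      conv_lhs => rw [← X_mul_divX_add (f j), map_add, map_mul, aeval_X, aeval_C]
      rfl
    have hz : ∑ j, (f j).coeff 0 • m j ∈ A ⊔ LinearMap.range t := by
      have h1 := hmono (show 1 ≤ d + 1 by omega) h
      rw [pow_one, hsum] at h1
      exact (Submodule.add_mem_iff_right _ (Submodule.mem_sup_right (LinearMap.mem_range_self t _))).mp h1
    have h0 := hm _ hz
    have hz' : ∑ j, (f j).coeff 0 • m j ∈ A ⊔ LinearMap.range (t ^ (d + 1)) := by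
      choose g hg using h0
      simp only [hg, mul_smul, ← Finset.smul_sum]
      exact hmono hd (hp _)
    rw [hsum, Submodule.add_mem_iff_left _ hz'] at h
    obtain ⟨a, ha, _, ⟨w, rfl⟩, haw⟩ := Submodule.mem_sup.mp h
    have hy : ∑ j, aeval t (f j).divX (m j) - (t ^ d) w ∈ A := by
      apply hinj
      rw [map_sub, ← haw, pow_succ']
      simpa using ha
    have hy' : ∑ j, aeval t (f j).divX (m j) ∈ A ⊔ LinearMap.range (t ^ d) := by
      rw [← sub_add_cancel (∑ j, aeval t (f j).divX (m j)) ((t ^ d) w)]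
      exact Submodule.add_mem_sup hy ⟨w, rfl⟩
    intro j i hi
    cases i with
    | zero => exact h0 j
    | succ i =>
      rw [← coeff_divX]
      exact ih (by omega) _ hy' j i (by omega)

variable {q : ℕ} {T : Module.End R M} {A : Submodule R M} {w : κ → M}

theorem pow_apply_mod (hT : ∀ x ∈ A, (T ^ q) x = x) (i : ℕ) {x : M} (hx : x ∈ A) :
    (T ^ (i % q)) x = (T ^ i) x := by
  conv_rhs => rw [← Nat.mod_add_div i q, pow_add, pow_mul]
  rw [Module.End.mul_apply]
  congr 1
  induction i / q with
  | zero => rfl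
  | succ k ih => rw [pow_succ, Module.End.mul_apply, hT x hx, ← ih]

theorem exists_complement_of_independent_orbit [IsLocalRing R] [Module.Finite R M] [Module.Free R M]
    (hp : IsLocalRing.maximalIdeal R = Ideal.span {p}) (hq : 0 < q)
    (hTA : ∀ x ∈ A, T x ∈ A) (hT : ∀ x ∈ A, (T ^ q) x = x) (hw : ∀ j, w j ∈ A)
    (h : ∀ (c : Fin q × κ → R) (x : M), ∑ i, c i • (T ^ (i.1 : ℕ)) (w i.2) = p • x →
      ∀ i, p ∣ c i) :
    ∃ A' ≤ A, (∀ x ∈ A', T x ∈ A') ∧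
      Disjoint (Submodule.span R (Set.range fun i : ℕ × κ => (T ^ i.1) (w i.2))) A' ∧
      A ≤ Submodule.span R (Set.range fun i : ℕ × κ => (T ^ i.1) (w i.2)) ⊔ A' := by
  classical
  obtain ⟨f, hf⟩ := exists_dual_family hp _ h
  have hpow : ∀ n, ∀ x ∈ A, (T ^ n) x ∈ A := by
    intro n x hx
    induction n with
    | zero => exact hx
    | succ n ih => rw [pow_succ']; exact hTA _ ih
  let l : κ → M →ₗ[R] R := fun j => f (⟨0, hq⟩, j)
  have hl : ∀ (e : ℕ) (j j' : κ), l j ((T ^ e) (w j')) = if q ∣ e ∧ j = j' then 1 else 0 := by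
    intro e j j'
    rw [← pow_apply_mod hT e (hw j')]
    have := hf (⟨0, hq⟩, j) (⟨e % q, Nat.mod_lt _ hq⟩, j')
    simp only [l, this, Prod.mk.injEq, Fin.mk.injEq]
    simp only [Nat.dvd_iff_mod_eq_zero, eq_comm]
  -- Projection to the span of the orbits, built from the functionals dual to the w j. The exponent
  -- q - i stands for -i, since T^q = 1 on A.
  let v : M →ₗ[R] M :=
    ∑ i ∈ Finset.range q, ∑ j, (l j ∘ₗ (T ^ i)).smulRight ((T ^ (q - i)) (w j))
  have hv : ∀ x, v x = ∑ i ∈ Finset.range q, ∑ j, l j ((T ^ i) x) • (T ^ (q - i)) (w j) := by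
    intro x; simp [v]
  have hvL : ∀ x, v x ∈ Submodule.span R (Set.range fun i : ℕ × κ => (T ^ i.1) (w i.2)) := by
    intro x
    rw [hv]
    exact Submodule.sum_mem _ fun i _ => Submodule.sum_mem _ fun j _ =>
      Submodule.smul_mem _ _ (Submodule.subset_span ⟨(q - i, j), rfl⟩)
  have hvA : ∀ x, v x ∈ A := by
    intro x
    rw [hv]
    exact Submodule.sum_mem _ fun i _ => Submodule.sum_mem _ fun j _ =>
      Submodule.smul_mem _ _ (hpow _ _ (hw j))
  have hlv : ∀ x j, ∀ s < q, l j ((T ^ s) (v x)) = l j ((T ^ s) x) := by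
    intro x j s hs
    simp only [hv, map_sum, map_smul, ← Module.End.mul_apply, ← pow_add, hl, smul_eq_mul,
      mul_ite, mul_one, mul_zero]
    rw [Finset.sum_eq_single_of_mem s (Finset.mem_range.mpr hs)]
    · rw [Finset.sum_eq_single_of_mem j (Finset.mem_univ _)]
      · rw [if_pos]
        exact ⟨by rw [Nat.add_sub_cancel' hs.le], rfl⟩
      · intro j' _ hj'
        rw [if_neg]
        tauto
    · intro i hi his
      rw [Finset.mem_range] at hi
      refine Finset.sum_eq_zero fun j' _ => if_neg ?_
      rintro ⟨⟨c, hc⟩, -⟩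
      have hc1 : c = 1 := by
        rcases c with _ | _ | c
        · omega
        · rfl
        · exfalso
          rw [mul_add, mul_add] at hc
          have := Nat.zero_le (q * c)
          omega
      subst hc1
      omega
  have hvw : ∀ e j, v ((T ^ e) (w j)) = (T ^ e) (w j) := by
    intro e j
    rw [← pow_apply_mod hT e (hw j)]
    have he := Nat.mod_lt e hq
    generalize e % q = e at he
    simp only [hv, ← Module.End.mul_apply, ← pow_add, hl, ite_smul, one_smul, zero_smul]
    rw [Finset.sum_comm, Finset.sum_eq_single_of_mem j (Finset.mem_univ _)]
    · rcases Nat.eq_zero_or_pos e with rfl | he0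
      · rw [Finset.sum_eq_single_of_mem 0 (Finset.mem_range.mpr hq)]
        · simpa using hT _ (hw j)
        · intro i hi hi0
          rw [Finset.mem_range] at hi
          refine if_neg ?_
          rintro ⟨hd, -⟩
          have := Nat.le_of_dvd (by omega) hd
          omega
      · rw [Finset.sum_eq_single_of_mem (q - e) (Finset.mem_range.mpr (by omega))]
        · rw [if_pos ⟨by rw [Nat.sub_add_cancel he.le], rfl⟩]
          congr 2
          omega
        · intro i hi hi0
          rw [Finset.mem_range] at hi
          refine if_neg ?_
          rintro ⟨⟨c, hc⟩, -⟩
          rcases c with _ | _ | c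
          · omega
          · omega
          · rw [mul_add, mul_add] at hc
            have := Nat.zero_le (q * c)
            omega
    · intro j' _ hj'
      refine Finset.sum_eq_zero fun i _ => if_neg ?_
      tauto
  -- Letting s run over all naturals makes T-stability immediate; on A only s < q matters.
  refine ⟨A ⊓ ⨅ s, ⨅ j, LinearMap.ker (l j ∘ₗ (T ^ s)), inf_le_left, ?_, ?_, ?_⟩
  · rintro x ⟨hx, hx'⟩
    refine ⟨hTA x hx, ?_⟩
    simp only [SetLike.mem_coe, Submodule.mem_iInf, LinearMap.mem_ker, LinearMap.comp_apply] at hx' ⊢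
    intro s j
    rw [← Module.End.mul_apply, ← pow_succ]
    exact hx' _ _
  · rw [Submodule.disjoint_def]
    rintro x hx ⟨-, hx'⟩
    simp only [SetLike.mem_coe, Submodule.mem_iInf, LinearMap.mem_ker, LinearMap.comp_apply] at hx'
    have hvx : v x = x := by
      have : Submodule.span R (Set.range fun i : ℕ × κ => (T ^ i.1) (w i.2)) ≤
          LinearMap.eqLocus v LinearMap.id := by
        rw [Submodule.span_le]
        rintro _ ⟨i, rfl⟩
        exact hvw _ _
      exact this hx
    rw [← hvx, hv]
    simp [hx']
  · intro x hx
    rw [← add_sub_cancel (v x) x]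
    refine Submodule.add_mem_sup (hvL x) ⟨A.sub_mem hx (hvA x), ?_⟩
    simp only [SetLike.mem_coe, Submodule.mem_iInf, LinearMap.mem_ker, LinearMap.comp_apply]
    intro s j
    rw [← pow_apply_mod hT s (A.sub_mem hx (hvA x)), map_sub, map_sub,
      hlv _ _ _ (Nat.mod_lt _ hq), sub_self]

end PermutationLattice

namespace PermutationLattice

/-! ### The norm of the subgroup of order p -/

section Identities

variable {R M : Type*} [CommRing R] [AddCommGroup M] [Module R M] {p : ℕ} {T : Module.End R M}

/-- The norm of the subgroup of order `p` generated by `T ^ q`. -/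
noncomputable def normEnd (T : Module.End R M) (q p : ℕ) : Module.End R M :=
  ∑ i ∈ Finset.range p, (T ^ q) ^ i

theorem aeval_eq_aeval_sub_one (f : R[X]) : aeval T f = aeval (T - 1) (taylor 1 f) := by
  rw [taylor_apply, aeval_comp]
  simp

theorem aeval_sub_one_eq_aeval (f : R[X]) : aeval (T - 1) f = aeval T (taylor (-1) f) := by
  rw [aeval_eq_aeval_sub_one (taylor (-1) f), taylor_taylor]
  simp

theorem commute_normEnd_aeval (q : ℕ) (f : R[X]) : Commute (normEnd T q p) (aeval T f) := by
  have : normEnd T q p = aeval T (∑ i ∈ Finset.range p, ((X : R[X]) ^ q) ^ i) := by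
    simp [normEnd]
  rw [this, commute_iff_eq, ← map_mul, ← map_mul, mul_comm]

theorem exists_pow_sub_self_eq (hp : p.Prime) (n : ℕ) (T : Module.End R M) :
    ∃ h : Module.End R M, ∀ x, (T ^ p ^ n) x - x = ((T - 1) ^ p ^ n) x + (p : R) • h x := by
  obtain ⟨h, hh⟩ := exists_X_pow_sub_one_eq hp n
  refine ⟨aeval T h, fun x => ?_⟩
  have := LinearMap.congr_fun (congrArg (aeval T) hh) x
  simpa [Nat.cast_smul_eq_nsmul] using this

theorem exists_normEnd_apply_eq (hp : p.Prime) (n : ℕ) (T : Module.End R M) :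
    ∃ h : Module.End R M, Commute (T - 1) h ∧ ∀ x, normEnd T (p ^ n) p x =
      ((T - 1) ^ (p ^ n * (p - 1))) x + (p : R) • (x + (T - 1) (h x)) := by
  obtain ⟨h, hh⟩ := exists_geom_sum_eq hp n
  refine ⟨aeval T h, ?_, fun x => ?_⟩
  · rw [show T - 1 = aeval T (X - 1 : ℤ[X]) by simp, commute_iff_eq, ← map_mul, ← map_mul, mul_comm]
  · have := LinearMap.congr_fun (congrArg (aeval T) hh) x
    simpa [Nat.cast_smul_eq_nsmul, normEnd] using this

theorem exists_normEnd_apply_eq_add_sub (q : ℕ) (T : Module.End R M) :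
    ∃ h : Module.End R M, ∀ x, normEnd T q p x = (p : R) • x + ((T ^ q) (h x) - h x) := by
  obtain ⟨h, hh⟩ : (X - C 1 : ℤ[X]) ∣ ∑ i ∈ Finset.range p, X ^ i - (p : ℤ[X]) := by
    rw [dvd_iff_isRoot]; simp [eval_finsetSum]
  refine ⟨aeval (T ^ q) h, fun x => ?_⟩
  rw [sub_eq_iff_eq_add'] at hh
  have := LinearMap.congr_fun (congrArg (aeval (T ^ q)) hh) x
  simpa [Nat.cast_smul_eq_nsmul, normEnd] using this

theorem pow_apply_normEnd {q : ℕ} (hT : T ^ (q * p) = 1) (x : M) :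
    (T ^ q) (normEnd T q p x) = normEnd T q p x := by
  have := mul_geom_sum (T ^ q) p
  rw [← pow_mul, hT, sub_self] at this
  have := LinearMap.congr_fun this x
  simpa [sub_mul, sub_eq_zero, normEnd] using this

theorem normEnd_apply_pow {q : ℕ} (hT : T ^ (q * p) = 1) (x : M) :
    normEnd T q p ((T ^ q) x) = normEnd T q p x := by
  have := geom_sum_mul (T ^ q) p
  rw [← pow_mul, hT, sub_self] at this
  have := LinearMap.congr_fun this x
  simpa [mul_sub, sub_eq_zero, normEnd] using this

theorem normEnd_apply_of_pow_apply {q : ℕ} {x : M} (hx : (T ^ q) x = x) :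
    normEnd T q p x = (p : R) • x := by
  have : ∀ i, ((T ^ q) ^ i) x = x := by
    intro i
    induction i with
    | zero => rfl
    | succ i ih => rw [pow_succ, Module.End.mul_apply, hx, ih]
  simp [normEnd, this, Nat.cast_smul_eq_nsmul]

theorem exists_sub_one_pow_apply_eq (hp : p.Prime) (hT : T ^ p ^ n = 1) (x : M) :
    ∃ y, ((T - 1) ^ p ^ n) x = (p : R) • y := by
  obtain ⟨h, hh⟩ := exists_pow_sub_self_eq hp n T
  refine ⟨- h x, ?_⟩
  have := hh x
  rw [hT, Module.End.one_apply, sub_self] at this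
  rw [smul_neg, eq_neg_iff_add_eq_zero, this]

/-- With t = T - 1, N = t^(q(p-1)) + p(1 + th) and N has values in the kernel, so the claim holds
for elements (1 + th)x. These are all of M, because t is nilpotent modulo p. -/
theorem smul_mem_ker_sup_range [IsLocalRing R] [Module.Finite R M] (hp : p.Prime)
    (hmax : IsLocalRing.maximalIdeal R = Ideal.span {(p : R)}) (hT : T ^ p ^ (n + 1) = 1) (x : M) :
    (p : R) • x ∈ LinearMap.ker (T ^ p ^ n - 1) ⊔ LinearMap.range ((T - 1) ^ (p ^ n * (p - 1))) := by
  obtain ⟨h, hcomm, hh⟩ := exists_normEnd_apply_eq hp n T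
  have htop : LinearMap.range (1 + (T - 1) * h) = ⊤ := by
    refine eq_top_of_sup_range_eq_top (t := T - 1)
      (by rw [hmax]; exact Ideal.mem_span_singleton_self (p : R)) ?_ ?_
      (exists_sub_one_pow_apply_eq hp hT)
    · rintro _ ⟨x, rfl⟩
      refine ⟨(T - 1) x, ?_⟩
      simp only [← Module.End.mul_apply]
      rw [((Commute.one_right _).add_right ((Commute.refl _).mul_right hcomm)).eq]
    · rw [eq_top_iff]
      intro x _
      rw [show x = (1 + (T - 1) * h) x + (T - 1) (-h x) by simp; abel]
      exact Submodule.add_mem_sup ⟨x, rfl⟩ ⟨_, rfl⟩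
  obtain ⟨x, rfl⟩ : x ∈ LinearMap.range (1 + (T - 1) * h) := htop ▸ Submodule.mem_top
  have := hh x
  rw [← sub_eq_iff_eq_add', sub_eq_add_neg, ← map_neg] at this
  change (p : R) • (x + (T - 1) (h x)) ∈ _
  rw [← this]
  refine Submodule.add_mem_sup ?_ ⟨_, rfl⟩
  rw [LinearMap.mem_ker, LinearMap.sub_apply, pow_apply_normEnd (by rwa [← pow_succ])]
  simp

end Identities

theorem _root_.Polynomial.C_dvd_of_C_dvd_taylor {R : Type*} [CommRing R] {a r : R} {f : R[X]}
    (h : C a ∣ taylor r f) : C a ∣ f := by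
  obtain ⟨g, hg⟩ := h
  refine ⟨taylor (-r) g, ?_⟩
  have := congrArg (taylor (-r)) hg
  rwa [taylor_taylor, neg_add_cancel, taylor_zero, taylor_mul, taylor_C] at this

/-! ### Independence modulo p -/

section Step

variable {R M κ : Type*} [CommRing R] [IsDomain R] [AddCommGroup M] [Module R M]
  [Module.IsTorsionFree R M] [Fintype κ] {p n : ℕ} {T : Module.End R M}

/-- The element u = (T^q - 1)x is fixed by T, so N u = p u; but N (T^q - 1) = 0. -/
theorem mem_ker_of_sub_self_mem_ker {q : ℕ} (hp0 : (p : R) ≠ 0) (hT : T ^ (q * p) = 1) (x : M)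
    (hx : (T - 1) x ∈ LinearMap.ker (T ^ q - 1)) : x ∈ LinearMap.ker (T ^ q - 1) := by
  have h1 : T ((T ^ q - 1) x) = (T ^ q - 1) x := by
    have : (T - 1) ((T ^ q - 1) x) = 0 := by
      rw [← Module.End.mul_apply, show (T - 1) * (T ^ q - 1) = (T ^ q - 1) * (T - 1) by
        simp [mul_sub, sub_mul, ← pow_succ, ← pow_succ']; abel]
      exact hx
    simpa [sub_eq_zero] using this
  have h2 : (T ^ q) ((T ^ q - 1) x) = (T ^ q - 1) x := by
    generalize (T ^ q - 1) x = y at h1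
    clear hT hx
    induction q with
    | zero => rfl
    | succ k ih => rw [pow_succ, Module.End.mul_apply, h1, ih]
  have h3 := normEnd_apply_of_pow_apply (p := p) h2
  have h4 : normEnd T q p ((T ^ q - 1) x) = 0 := by
    simp [normEnd_apply_pow hT]
  rw [h4] at h3
  exact (smul_eq_zero.mp h3.symm).resolve_left hp0

theorem mem_ker_of_smul_mem_ker {q : ℕ} (hp0 : (p : R) ≠ 0) {x : M}
    (hx : (p : R) • x ∈ LinearMap.ker (T ^ q - 1)) : x ∈ LinearMap.ker (T ^ q - 1) := by
  rw [LinearMap.mem_ker, map_smul] at hx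
  exact (smul_eq_zero.mp hx).resolve_left hp0

variable [IsLocalRing R]

variable {m : κ → M}

theorem dvd_of_normEnd_sum_eq_smul [Module.Finite R M] (hp : p.Prime) (hp0 : (p : R) ≠ 0)
    (hmax : IsLocalRing.maximalIdeal R = Ideal.span {(p : R)}) (hT : T ^ p ^ (n + 1) = 1)
    (hcoinv : ∀ x y, (p : R) • x = (T ^ p ^ n) y - y → ∃ z, x = (T ^ p ^ n) z - z)
    (hm : ∀ c : κ → R, ∑ j, c j • m j ∈ LinearMap.ker (T ^ p ^ n - 1) ⊔ LinearMap.range (T - 1) →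
      ∀ j, (p : R) ∣ c j) (f : κ → R[X]) (hf : ∀ j, (f j).degree < (p ^ n : ℕ)) (x : M)
    (h : normEnd T (p ^ n) p (∑ j, aeval (T - 1) (f j) (m j)) = (p : R) • x) :
    ∀ j, C (p : R) ∣ f j := by
  have hT' : T ^ (p ^ n * p) = 1 := by rwa [← pow_succ]
  have hx : x ∈ LinearMap.ker (T ^ p ^ n - 1) := by
    apply mem_ker_of_smul_mem_ker hp0
    rw [← h, LinearMap.mem_ker, LinearMap.sub_apply, pow_apply_normEnd hT']
    simp
  set y := ∑ j, aeval (T - 1) (f j) (m j)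
  obtain ⟨g, hg⟩ := exists_normEnd_apply_eq_add_sub (p := p) (p ^ n) T
  -- N is p modulo T^q - 1, so p(y - x) lies in the image of T^q - 1; torsion-freeness removes p. As
  -- T^q - 1 is t^q modulo p, it follows that y ∈ A + t^q M.
  obtain ⟨z, hz⟩ := hcoinv (y - x) (- g y) (by
    rw [smul_sub, ← h, hg, map_neg]; abel)
  obtain ⟨g', hg'⟩ := exists_pow_sub_self_eq (R := R) hp n T
  have hle : p ^ n ≤ p ^ n * (p - 1) :=
    Nat.le_mul_of_pos_right _ (by have := hp.two_le; omega)
  have hsup : LinearMap.ker (T ^ p ^ n - 1) ⊔ LinearMap.range ((T - 1) ^ (p ^ n * (p - 1))) ≤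
      LinearMap.ker (T ^ p ^ n - 1) ⊔ LinearMap.range ((T - 1) ^ p ^ n) := by
    refine sup_le_sup_left ?_ _
    obtain ⟨c, hc⟩ := Nat.exists_eq_add_of_le hle
    rintro _ ⟨x, rfl⟩
    exact ⟨((T - 1) ^ c) x, by rw [hc, pow_add]; rfl⟩
  have hmem : y ∈ LinearMap.ker (T ^ p ^ n - 1) ⊔ LinearMap.range ((T - 1) ^ p ^ n) := by
    rw [← add_sub_cancel x y, hz, hg']
    exact add_mem (Submodule.mem_sup_left hx) (add_mem (Submodule.mem_sup_right ⟨_, rfl⟩)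
      (hsup (smul_mem_ker_sup_range hp hmax hT _)))
  intro j
  rw [C_dvd_iff_dvd_coeff]
  intro i
  by_cases hi : i < p ^ n
  · exact dvd_coeff_of_sum_aeval_mem (mem_ker_of_sub_self_mem_ker hp0 hT')
      (smul_mem_ker_sup_range hp hmax hT) hm hle f hmem j i hi
  · rw [coeff_eq_zero_of_degree_lt ((hf j).trans_le (by exact_mod_cast not_lt.mp hi))]
    exact dvd_zero _

/-- With e = q(p-1), t-adic digits below e are divisible by p. The top q digits form z with t^e z ≡
N z modulo p, so N z + a ∈ pM; splitting along L ⊕ A' reduces to `dvd_of_normEnd_sum_eq_smul`. -/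
theorem dvd_of_sum_add_eq_smul [Module.Finite R M] (hp : p.Prime) (hp0 : (p : R) ≠ 0)
    (hmax : IsLocalRing.maximalIdeal R = Ideal.span {(p : R)}) (hT : T ^ p ^ (n + 1) = 1)
    (hcoinv : ∀ x y, (p : R) • x = (T ^ p ^ n) y - y → ∃ z, x = (T ^ p ^ n) z - z)
    (hm : ∀ c : κ → R, ∑ j, c j • m j ∈ LinearMap.ker (T ^ p ^ n - 1) ⊔ LinearMap.range (T - 1) →
      ∀ j, (p : R) ∣ c j) {L A' : Submodule R M}
    (hL : ∀ (f : R[X]) j, normEnd T (p ^ n) p (aeval T f (m j)) ∈ L)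
    (hA' : A' ≤ LinearMap.ker (T ^ p ^ n - 1)) (hdisj : Disjoint L A')
    (hsup : LinearMap.ker (T ^ p ^ n - 1) ≤ L ⊔ A')
    (f : κ → R[X]) (hf : ∀ j, (f j).degree < (p ^ n * p : ℕ)) {a x : M} (ha : a ∈ A')
    (h : ∑ j, aeval T (f j) (m j) + a = (p : R) • x) :
    (∀ j, C (p : R) ∣ f j) ∧ ∃ a' ∈ A', a = (p : R) • a' := by
  have hT' : T ^ (p ^ n * p) = 1 := by rwa [← pow_succ]
  have hcongr : ∀ j, aeval T (f j) (m j) = aeval (T - 1) (taylor 1 (f j)) (m j) := fun j => by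
    rw [aeval_eq_aeval_sub_one]
  simp only [hcongr] at h
  replace hf : ∀ j, (taylor 1 (f j)).degree < (p ^ n * p : ℕ) := by simpa using hf
  suffices (∀ j, C (p : R) ∣ taylor 1 (f j)) ∧ ∃ a' ∈ A', a = (p : R) • a' from
    ⟨fun j => C_dvd_of_C_dvd_taylor (this.1 j), this.2⟩
  obtain ⟨g, hg⟩ : ∃ g : κ → R[X], ∀ j, taylor 1 (f j) = g j := ⟨_, fun _ => rfl⟩
  simp only [hg] at *
  clear hg hcongr f
  set y := ∑ j, aeval (T - 1) (g j) (m j) with hy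
  have hφ : p ^ n * p = p ^ n * (p - 1) + p ^ n := by
    rw [← Nat.mul_succ, Nat.succ_eq_add_one, Nat.sub_add_cancel hp.one_le]
  set e := p ^ n * (p - 1) with he
  have hmem : y ∈ LinearMap.ker (T ^ p ^ n - 1) ⊔ LinearMap.range ((T - 1) ^ e) := by
    rw [eq_sub_of_add_eq h]
    exact sub_mem (smul_mem_ker_sup_range hp hmax hT x) (Submodule.mem_sup_left (hA' ha))
  have hlow := dvd_coeff_of_sum_aeval_mem (mem_ker_of_sub_self_mem_ker hp0 hT')
    (smul_mem_ker_sup_range hp hmax hT) hm le_rfl g hmem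
  let r : κ → R[X] := fun j => ∑ i ∈ Finset.range (p ^ n), C ((g j).coeff (e + i)) * X ^ i
  have hr : ∀ j i, i < p ^ n → (r j).coeff i = (g j).coeff (e + i) := by
    intro j i hi
    simp [r, hi]
  have hrdeg : ∀ j, (r j).degree < (p ^ n : ℕ) := by
    intro j
    rw [degree_lt_iff_coeff_zero]
    intro i hi
    simp [r, not_lt.mpr hi]
  have hgr : ∀ j, C (p : R) ∣ g j - X ^ e * r j := by
    intro j
    rw [C_dvd_iff_dvd_coeff]
    intro i
    rw [coeff_sub, coeff_X_pow_mul']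
    split_ifs with hi
    · obtain ⟨i, rfl⟩ := Nat.exists_eq_add_of_le hi
      rw [Nat.add_sub_cancel_left]
      by_cases hi' : i < p ^ n
      · rw [hr j i hi', sub_self]
        exact dvd_zero _
      · rw [coeff_eq_zero_of_degree_lt ((hf j).trans_le (by
            rw [hφ]; exact_mod_cast Nat.add_le_add_left (not_lt.mp hi') e)),
          coeff_eq_zero_of_degree_lt ((hrdeg j).trans_le (by exact_mod_cast not_lt.mp hi')),
          sub_self]
        exact dvd_zero _
    · rw [sub_zero]
      exact hlow j i (not_le.mp hi)
  choose u hu using hgr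
  replace hu : ∀ j, g j = X ^ e * r j + C (p : R) * u j := fun j => sub_eq_iff_eq_add'.mp (hu j)
  set z := ∑ j, aeval (T - 1) (r j) (m j) with hz
  have hyz : y = ((T - 1) ^ e) z + (p : R) • ∑ j, aeval (T - 1) (u j) (m j) := by
    simp only [hy, hz, hu, map_sum, Finset.smul_sum, ← Finset.sum_add_distrib]
    refine Finset.sum_congr rfl fun j _ => ?_
    rw [map_add, map_mul, map_mul, map_pow, aeval_X, aeval_C]
    rfl
  obtain ⟨N', -, hN'⟩ := exists_normEnd_apply_eq (R := R) hp n T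
  obtain ⟨x', hx'⟩ : ∃ x', normEnd T (p ^ n) p z + a = (p : R) • x' := by
    refine ⟨x - ∑ j, aeval (T - 1) (u j) (m j) + (z + (T - 1) (N' z)), ?_⟩
    rw [hN', ← he, smul_add (p : R) (x - _), smul_sub, ← h, hyz]
    abel
  have hNz : normEnd T (p ^ n) p z ∈ L := by
    rw [hz, map_sum]
    exact sum_mem fun j _ => by rw [aeval_sub_one_eq_aeval]; exact hL _ j
  have hx'A : x' ∈ LinearMap.ker (T ^ p ^ n - 1) := by
    apply mem_ker_of_smul_mem_ker hp0
    rw [← hx']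
    refine add_mem ?_ (hA' ha)
    rw [LinearMap.mem_ker, LinearMap.sub_apply, pow_apply_normEnd hT']
    simp
  obtain ⟨l, hl, a', ha', rfl⟩ := Submodule.mem_sup.mp (hsup hx'A)
  rw [smul_add] at hx'
  have hdiff : normEnd T (p ^ n) p z - (p : R) • l = (p : R) • a' - a := by
    rw [sub_eq_sub_iff_add_eq_add, hx', add_comm]
  have h0 : normEnd T (p ^ n) p z - (p : R) • l = 0 :=
    (Submodule.disjoint_def.mp hdisj) _ (sub_mem hNz (L.smul_mem _ hl))
      (hdiff ▸ sub_mem (A'.smul_mem _ ha') ha)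
  refine ⟨fun j => ?_, a', ha', (sub_eq_zero.mp (hdiff ▸ h0)).symm⟩
  rw [hu]
  exact dvd_add (dvd_mul_of_dvd_right (dvd_of_normEnd_sum_eq_smul hp hp0 hmax hT hcoinv hm r hrdeg l
    (sub_eq_zero.mp h0) j) _) (dvd_mul_right _ _)

end Step

end PermutationLattice

/-! ### The induction producing a permuted basis -/

namespace PermutationLattice

variable {R M : Type*} [CommRing R] [AddCommGroup M] [Module R M] {p n : ℕ} {T : Module.End R M}

theorem _root_.Polynomial.exists_degree_lt_coeff_eq {R : Type*} [CommRing R] {d : ℕ}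
    (c : Fin d → R) : ∃ f : R[X], f.degree < d ∧ (∀ i : Fin d, f.coeff i = c i) ∧
      ∀ {M : Type*} [AddCommGroup M] [Module R M] (T : Module.End R M) (x : M),
        aeval T f x = ∑ i, c i • (T ^ (i : ℕ)) x := by
  refine ⟨∑ i, C (c i) * X ^ (i : ℕ), degree_sum_fin_lt c, fun i => ?_, fun T x => ?_⟩
  · simp [Fin.val_inj]
  · simp [LinearMap.sum_apply]

/-- The coinvariants of `T ^ p ^ j` have no `p`-torsion for all `j ≤ n`. -/
def CoinvariantsTorsionFree (p n : ℕ) (T : Module.End R M) : Prop :=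
  ∀ j ≤ n, ∀ x y, (p : R) • x = (T ^ p ^ j) y - y → ∃ z, x = (T ^ p ^ j) z - z

theorem restrict_pow_apply {A : Submodule R M} (hA : ∀ x ∈ A, T x ∈ A) (k : ℕ) (x : A) :
    (((T.restrict hA) ^ k) x : M) = (T ^ k) x := by
  rw [Module.End.pow_restrict]
  rfl

theorem CoinvariantsTorsionFree.restrict [IsDomain R] [Module.IsTorsionFree R M]
    (hp0 : (p : R) ≠ 0)
    (h : CoinvariantsTorsionFree p (n + 1) T) {L A : Submodule R M} (hTL : ∀ x ∈ L, T x ∈ L)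
    (hA : ∀ x ∈ A, T x ∈ A) (hdisj : Disjoint L A) (hsup : LinearMap.ker (T ^ p ^ n - 1) ≤ L ⊔ A)
    (hAker : A ≤ LinearMap.ker (T ^ p ^ n - 1)) :
    CoinvariantsTorsionFree p n (T.restrict hA) := by
  have hpow : ∀ {B : Submodule R M}, (∀ x ∈ B, T x ∈ B) → ∀ k, ∀ x ∈ B, (T ^ k) x ∈ B := by
    intro B hB k x hx
    induction k with
    | zero => exact hx
    | succ k ih => rw [pow_succ']; exact hB _ ih
  intro j hj x y hxy
  replace hxy : (p : R) • (x : M) = (T ^ p ^ j) (y : M) - y := by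
    simpa [restrict_pow_apply] using congrArg Subtype.val hxy
  obtain ⟨z, hz⟩ := h j (by omega) x y hxy
  set S := T ^ p ^ j with hS
  have hSq : S ^ p ^ (n - j) = T ^ p ^ n := by
    rw [hS, ← pow_mul, ← pow_add, Nat.add_sub_cancel' hj]
  have hG := geom_sum_mul S (p ^ (n - j))
  rw [hSq] at hG
  set G := ∑ i ∈ Finset.range (p ^ (n - j)), S ^ i
  -- G(S - 1) = T^(p^n) - 1 kills y, so p • G x = 0 and hence (T^(p^n) - 1)z = G x = 0. The
  -- A-component of z is then the required witness.
  have hzker : z ∈ LinearMap.ker (T ^ p ^ n - 1) := by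
    have h1 : (T ^ p ^ n - 1) z = G x := by
      rw [← hG, hz]; rfl
    have h2 : (p : R) • G x = 0 := by
      rw [← map_smul, hxy]
      have : (T ^ p ^ n - 1) (y : M) = 0 := hAker y.2
      rw [← hG] at this
      exact this
    rw [LinearMap.mem_ker, h1]
    exact (smul_eq_zero.mp h2).resolve_left hp0
  obtain ⟨l, hl, a, ha, rfl⟩ := Submodule.mem_sup.mp (hsup hzker)
  rw [map_add] at hz
  have hdiff : S l - l = x - (S a - a) := by rw [hz]; abel
  have h0 : S l - l = 0 := Submodule.disjoint_def.mp hdisj _ (sub_mem (hpow hTL _ _ hl) hl)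
    (hdiff ▸ sub_mem x.2 (sub_mem (hpow hA _ _ ha) ha))
  refine ⟨⟨a, ha⟩, ?_⟩
  ext
  rw [Submodule.coe_sub, restrict_pow_apply]
  exact sub_eq_zero.mp (hdiff ▸ h0)

theorem exists_basis_forall_apply_mem_range [IsDomain R] [IsDiscreteValuationRing R] (hp : p.Prime)
    (hmax : IsLocalRing.maximalIdeal R = Ideal.span {(p : R)}) [Module.Finite R M]
    [Module.Free R M] (hT : T ^ p ^ n = 1) (h : CoinvariantsTorsionFree p n T) :
    ∃ (ι : Type) (_ : Finite ι) (b : Module.Basis ι R M), ∀ i, ∃ j, T (b i) = b j := by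
  induction n generalizing M with
  | zero =>
    rw [pow_zero, pow_one] at hT
    subst hT
    exact ⟨_, inferInstance, Module.finBasis R M, fun i => ⟨i, rfl⟩⟩
  | succ n ih =>
    have hp0 : (p : R) ≠ 0 := by
      intro h0
      rw [h0, Ideal.span_singleton_zero] at hmax
      exact IsDiscreteValuationRing.not_a_field R hmax
    have hpos : 0 < p - 1 := by have := hp.two_le; omega
    have hT' : T ^ (p ^ n * p) = 1 := by rwa [← pow_succ]
    set q := p ^ n with hq
    have hq0 : 0 < q := pow_pos hp.pos n
    set A := LinearMap.ker (T ^ q - 1) with hA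
    have hTA : ∀ x ∈ A, T x ∈ A := by
      intro x hx
      rw [hA, LinearMap.mem_ker] at hx ⊢
      rw [← Module.End.mul_apply,
        (((Commute.refl T).pow_left q).sub_left (Commute.one_left T)).eq, Module.End.mul_apply, hx,
        map_zero]
    have hqA : ∀ x ∈ A, (T ^ q) x = x := fun x hx => sub_eq_zero.mp hx
    have hpA : ∀ x, (p : R) • x ∈ A ⊔ LinearMap.range (T - 1) := by
      intro x
      refine sup_le_sup_left ?_ A (smul_mem_ker_sup_range hp hmax hT x)
      rintro _ ⟨y, rfl⟩
      rw [← Nat.sub_add_cancel (Nat.mul_pos hq0 hpos : 1 ≤ q * (p - 1)), pow_succ']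
      exact ⟨_, rfl⟩
    obtain ⟨k, m, hspan, hm⟩ := exists_minimal_generators (A ⊔ LinearMap.range (T - 1)) hmax hpA
    have hcoinv := h n (by omega)
    let w : Fin k → M := fun j => normEnd T q p (m j)
    have hwA : ∀ j, w j ∈ A := by
      intro j
      rw [hA, LinearMap.mem_ker, LinearMap.sub_apply, pow_apply_normEnd hT']
      exact sub_self _
    have hNT : ∀ i j, (T ^ i) (w j) = normEnd T q p ((T ^ i) (m j)) := by
      intro i j
      have := (commute_normEnd_aeval (T := T) (p := p) q ((X : R[X]) ^ i)).eq
      rw [map_pow, aeval_X] at this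
      exact (LinearMap.congr_fun this (m j)).symm
    obtain ⟨A', hA'A, hTA', hdisj, hsup⟩ := exists_complement_of_independent_orbit hmax hq0 hTA hqA
        hwA (by
      intro c x hx
      choose f hfdeg hfcoeff hf using fun j => exists_degree_lt_coeff_eq fun i : Fin q => c (i, j)
      have h1 : normEnd T q p (∑ j, aeval T (f j) (m j)) = (p : R) • x := by
        rw [← hx, Fintype.sum_prod_type_right, map_sum]
        refine Finset.sum_congr rfl fun j _ => ?_
        rw [hf, map_sum]
        refine Finset.sum_congr rfl fun i _ => ?_
        rw [map_smul, hNT]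
      have hcongr : ∀ j, aeval T (f j) (m j) = aeval (T - 1) (taylor 1 (f j)) (m j) := fun j => by
        rw [aeval_eq_aeval_sub_one]
      simp only [hcongr] at h1
      rintro ⟨i, j⟩
      have h2 := C_dvd_of_C_dvd_taylor
        (dvd_of_normEnd_sum_eq_smul hp hp0 hmax hT hcoinv hm _
          (fun j => by rw [degree_taylor]; exact hfdeg j) x h1 j)
      rw [C_dvd_iff_dvd_coeff] at h2
      rw [← hfcoeff]
      exact h2 i)
    set L := Submodule.span R (Set.range fun i : ℕ × Fin k => (T ^ i.1) (w i.2)) with hL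
    have hTL : ∀ x ∈ L, T x ∈ L := by
      have : L ≤ L.comap T := by
        conv_lhs => rw [hL]
        rw [Submodule.span_le]
        rintro _ ⟨i, rfl⟩
        refine Submodule.subset_span ⟨(i.1 + 1, i.2), ?_⟩
        change (T ^ (i.1 + 1)) (w i.2) = _
        rw [pow_succ']
        rfl
      exact this
    obtain ⟨ι, _, b, hb⟩ := ih (T := T.restrict hTA')
      (by
        ext x
        rw [restrict_pow_apply]
        exact hqA x (hA'A x.2))
      (h.restrict hp0 hTL hTA' hdisj hsup hA'A)
    have := Fintype.ofFinite ι
    let v : (Fin (q * p) × Fin k) ⊕ ι → M :=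
      Sum.elim (fun i => (T ^ (i.1 : ℕ)) (m i.2)) (fun i => b i)
    have hTv : ∀ i, ∃ j, T (v i) = v j := by
      rintro (⟨i, j⟩ | i)
      · by_cases hi : (i : ℕ) + 1 < q * p
        · exact ⟨Sum.inl (⟨i + 1, hi⟩, j), by simp [v, pow_succ']⟩
        · refine ⟨Sum.inl (⟨0, Nat.mul_pos hq0 hp.pos⟩, j), ?_⟩
          have hi' : (i : ℕ) + 1 = q * p := by omega
          have := LinearMap.congr_fun hT' (m j)
          rw [← hi', pow_succ'] at this
          exact this
      · obtain ⟨j, hj⟩ := hb i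
        exact ⟨Sum.inr j, congrArg Subtype.val hj⟩
    have hLf : ∀ (f : R[X]) j, normEnd T q p (aeval T f (m j)) ∈ L := by
      intro f j
      rw [aeval_eq_sum_range, LinearMap.sum_apply, map_sum]
      refine sum_mem fun i _ => ?_
      rw [LinearMap.smul_apply, map_smul, ← hNT]
      exact L.smul_mem _ (Submodule.subset_span ⟨(i, j), rfl⟩)
    have hli : LinearIndependent R v := by
      classical
      obtain ⟨φ, hφ⟩ := exists_dual_family hmax v (by
        intro c x hx
        choose f hfdeg hfcoeff hf using
          fun j => exists_degree_lt_coeff_eq fun i : Fin (q * p) => c (Sum.inl (i, j))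
        have h1 : ∑ j, aeval T (f j) (m j) + ((∑ i, c (Sum.inr i) • b i : A') : M) =
            (p : R) • x := by
          rw [← hx, Fintype.sum_sum_type, Fintype.sum_prod_type_right]
          congr 1
          · exact Finset.sum_congr rfl fun j _ => hf j T (m j)
          · simp [v]
        obtain ⟨h2, a', ha', h3⟩ := dvd_of_sum_add_eq_smul hp hp0 hmax hT hcoinv hm hLf hA'A hdisj
          hsup f hfdeg (Subtype.coe_prop _) h1
        rintro (⟨i, j⟩ | i)
        · have := h2 j
          rw [C_dvd_iff_dvd_coeff] at this
          rw [← hfcoeff]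
          exact this i
        · have h4 : ∑ i, c (Sum.inr i) • b i = (p : R) • (⟨a', ha'⟩ : A') := Subtype.ext h3
          refine ⟨b.repr ⟨a', ha'⟩ i, ?_⟩
          have h5 := congrFun (b.repr_sum_self fun i => c (Sum.inr i)) i
          rw [h4, map_smul] at h5
          exact h5.symm)
      rw [Fintype.linearIndependent_iff]
      intro c hc i
      have h1 := congrArg (φ i) hc
      simpa only [map_sum, map_smul, hφ, smul_eq_mul, mul_ite, mul_one, mul_zero,
        Finset.sum_ite_eq, Finset.mem_univ, if_true, map_zero] using h1
    have hTS : ∀ x ∈ Submodule.span R (Set.range v), T x ∈ Submodule.span R (Set.range v) := by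
      have : Submodule.span R (Set.range v) ≤ (Submodule.span R (Set.range v)).comap T := by
        rw [Submodule.span_le]
        rintro _ ⟨i, rfl⟩
        obtain ⟨j, hj⟩ := hTv i
        exact Submodule.subset_span ⟨j, hj.symm⟩
      exact this
    have hTpow : ∀ e, ∀ x ∈ Submodule.span R (Set.range v),
        (T ^ e) x ∈ Submodule.span R (Set.range v) := by
      intro e x hx
      induction e with
      | zero => exact hx
      | succ e ih => rw [pow_succ']; exact hTS _ ih
    have hmv : ∀ j, m j ∈ Submodule.span R (Set.range v) := fun j =>
      Submodule.subset_span ⟨Sum.inl (⟨0, Nat.mul_pos hq0 hp.pos⟩, j), rfl⟩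
    -- M is generated by the m j, A and (T - 1)M, and A ≤ L + A' lies in the span of v.
    have hspanv : Submodule.span R (Set.range v) = ⊤ := by
      refine eq_top_of_sup_range_eq_top (t := T - 1)
        (by rw [hmax]; exact Ideal.mem_span_singleton_self (p : R))
        (fun x hx => sub_mem (hTS x hx) hx) ?_ (exists_sub_one_pow_apply_eq hp hT)
      rw [eq_top_iff, ← hspan]
      refine sup_le ?_ (sup_le ?_ le_sup_right)
      · rw [Submodule.span_le]
        rintro _ ⟨j, rfl⟩
        exact Submodule.mem_sup_left (hmv j)
      · refine (hsup.trans (sup_le ?_ ?_)).trans le_sup_left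
        · rw [hL, Submodule.span_le]
          rintro _ ⟨i, rfl⟩
          refine hTpow _ _ ?_
          simp only [w, normEnd, LinearMap.sum_apply, ← pow_mul]
          exact sum_mem fun e _ => hTpow _ _ (hmv _)
        · intro x hx
          have h1 := congrArg Subtype.val (b.sum_repr ⟨x, hx⟩)
          rw [← show _ = x from h1, Submodule.coe_sum]
          exact sum_mem fun i _ => Submodule.smul_mem _ _ (Submodule.subset_span ⟨Sum.inr i, rfl⟩)
    refine ⟨_, inferInstance, Module.Basis.mk hli hspanv.ge, fun i => ?_⟩
    simpa using hTv i

end PermutationLattice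

/-! ### Coinvariants and permutation bases -/

namespace Representation

variable {R G M : Type*} [CommRing R] [Group G] [AddCommGroup M] [Module R M]
  {ρ : Representation R G M}

theorem IsLattice.moduleFinite [Finite G] (h : ρ.IsLattice) : Module.Finite R M := by
  have := h.finite
  have : Module.Finite R ρ.asModule := Module.Finite.trans R[G] ρ.asModule
  exact this

theorem isTorsionFree_coinvariants_iff [IsDomain R] [CharZero R] [Module.IsTorsionFree R M]
    [Fintype G] : Module.IsTorsionFree R ρ.Coinvariants ↔
      ∀ x, ρ.norm x = 0 → x ∈ Coinvariants.ker ρ := by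
  constructor
  · intro h x hx
    have h1 : (Fintype.card G : R) • Coinvariants.mk ρ x = 0 := by
      have h2 := congrArg (Coinvariants.mk ρ) hx
      simpa [norm, LinearMap.sum_apply, Nat.cast_smul_eq_nsmul] using h2
    rw [← Coinvariants.mk_eq_zero]
    exact (smul_eq_zero.mp h1).resolve_left (by exact_mod_cast Fintype.card_ne_zero)
  · intro h
    rw [Module.isTorsionFree_iff_smul_eq_zero]
    intro r x hx
    rw [or_iff_not_imp_left]
    intro hr
    obtain ⟨x, rfl⟩ := Coinvariants.mk_surjective ρ x
    rw [← map_smul, Coinvariants.mk_eq_zero] at hx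
    have hle : Coinvariants.ker ρ ≤ LinearMap.ker ρ.norm := by
      rw [Coinvariants.ker, Submodule.span_le]
      rintro _ ⟨⟨g, y⟩, rfl⟩
      simp
    have h1 := hle hx
    rw [LinearMap.mem_ker, map_smul] at h1
    rw [Coinvariants.mk_eq_zero]
    exact h _ ((smul_eq_zero.mp h1).resolve_left hr)

/-- The coinvariants embed in the free module on the orbits; orbit representatives give a left
inverse. -/
theorem isTorsionFree_coinvariants_of_basis {Ω : Type*} [MulAction G Ω]
    (b : Module.Basis Ω R M) (hb : ∀ g ω, ρ g (b ω) = b (g • ω)) :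
    Module.IsTorsionFree R ρ.Coinvariants := by
  let Q := MulAction.orbitRel.Quotient G Ω
  let f : M →ₗ[R] (Q →₀ R) := b.constr R fun ω => Finsupp.single (Quotient.mk'' ω) 1
  let F : ρ.Coinvariants →ₗ[R] (Q →₀ R) := Coinvariants.lift ρ f fun g => b.ext fun ω => by
    have : (Quotient.mk'' (g • ω) : Q) = Quotient.mk'' ω := Quotient.sound' ⟨g, rfl⟩
    simp [f, hb, this]
  let s : (Q →₀ R) →ₗ[R] ρ.Coinvariants :=
    Finsupp.linearCombination R fun x : Q => Coinvariants.mk ρ (b x.out)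
  have hs : s ∘ₗ F = LinearMap.id := by
    refine Coinvariants.hom_ext (b.ext fun ω => ?_)
    obtain ⟨g, hg⟩ : ((Quotient.mk'' ω : Q).out) ∈ MulAction.orbit G ω :=
      MulAction.orbitRel_apply.mp (Quotient.exact' (Quotient.out_eq' (Quotient.mk'' ω : Q)))
    have : Coinvariants.mk ρ (b (Quotient.mk'' ω : Q).out) = Coinvariants.mk ρ (b ω) := by
      rw [← hg]
      simp only [← hb, Coinvariants.mk_self_apply]
    simpa [F, f, s] using this
  exact Function.Injective.moduleIsTorsionFree F
    (Function.LeftInverse.injective (g := s) fun x => LinearMap.congr_fun hs x) (map_smul F)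

theorem IsPermutation.isTorsionFree_coinvariants (h : ρ.IsPermutation) (U : Subgroup G) :
    Module.IsTorsionFree R (Coinvariants (ρ.comp U.subtype)) := by
  obtain ⟨Ω, _, _, ⟨e⟩⟩ := h
  let b : Module.Basis Ω R M :=
    Module.Basis.ofRepr (e.toLinearEquiv.trans (MonoidAlgebra.coeffLinearEquiv R))
  have hb : ∀ ω, b ω = e.symm (MonoidAlgebra.single ω 1) := fun ω => rfl
  refine isTorsionFree_coinvariants_of_basis b fun g ω => ?_
  have h1 := LinearMap.congr_fun (e.symm.isIntertwining' (g : G)) (MonoidAlgebra.single ω 1)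
  rw [hb, hb]
  refine h1.symm.trans ?_
  rw [LinearMap.comp_apply, ofMulAction_single]
  rfl

theorem isPermutation_of_basis [Nontrivial R] [Finite G] {σ : G}
    (hσ : ∀ g, g ∈ Subgroup.zpowers σ) {ι : Type} [Finite ι] (b : Module.Basis ι R M)
    (hb : ∀ i, ∃ j, ρ σ (b i) = b j) : ρ.IsPermutation := by
  have hb' : ∀ g i, ∃ j, ρ g (b i) = b j := by
    intro g i
    obtain ⟨n, rfl⟩ := mem_powers_iff_mem_zpowers.mpr (hσ g)
    simp only
    induction n with
    | zero => exact ⟨i, by simp⟩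
    | succ n ih =>
      obtain ⟨j, hj⟩ := ih
      obtain ⟨k, hk⟩ := hb j
      exact ⟨k, by rw [pow_succ', map_mul, Module.End.mul_apply, hj, hk]⟩
  choose a ha using hb'
  let _ : MulAction G ι :=
    { smul := a
      one_smul := fun i => b.injective (by
        change b (a 1 i) = b i
        rw [← ha]; simp)
      mul_smul := fun g h i => b.injective (by
        change b (a (g * h) i) = b (a g (a h i))
        rw [← ha, ← ha, ← ha]; simp) }
  refine ⟨ι, inferInstance, inferInstance,
    ⟨Equiv.mk (b.repr.trans (MonoidAlgebra.coeffLinearEquiv R).symm) fun g => b.ext fun i => ?_⟩⟩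
  have h1 : ∀ i, (b.repr.trans (MonoidAlgebra.coeffLinearEquiv R).symm) (b i) =
      (MonoidAlgebra.single i 1 : R[ι]) := fun i => by
    rw [LinearEquiv.trans_apply, b.repr_self]
    rfl
  rw [LinearMap.comp_apply, LinearMap.comp_apply, ha]
  exact (h1 _).trans (by erw [h1, ofMulAction_single]; rfl)

end Representation

/-! ### First cohomology of cyclic groups, and the theorem -/

theorem Rep.surjective_groupCohomologyπOdd {k G : Type u} [CommRing k] [CommGroup G]
    [Fintype G] (A : Rep k G) (g : G) (hg : ∀ x, x ∈ Subgroup.zpowers g) (i : ℕ) (hi : Odd i) :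
    Function.Surjective (Rep.FiniteCyclicGroup.groupCohomologyπOdd A g hg i hi) := by
  intro y
  let e := Rep.FiniteCyclicGroup.groupCohomologyIsoOdd A g hg i hi
  let S := Rep.FiniteCyclicGroup.subCompNormHom A g
  obtain ⟨z, hz⟩ := (ModuleCat.epi_iff_surjective S.homologyπ).mp inferInstance (e.hom y)
  refine ⟨S.moduleCatCyclesIso.hom z, ?_⟩
  change e.inv (S.homologyπ (S.moduleCatCyclesIso.inv (S.moduleCatCyclesIso.hom z))) = y
  rw [CategoryTheory.Iso.hom_inv_id_apply, hz, CategoryTheory.Iso.hom_inv_id_apply]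

theorem Rep.subsingleton_H1_iff_of_forall_mem_zpowers {k G : Type u} [CommRing k] [Group G]
    [Fintype G] (A : Rep k G) (g : G) (hg : ∀ x, x ∈ Subgroup.zpowers g) :
    Subsingleton (groupCohomology A 1) ↔
      ∀ x, A.ρ.norm x = 0 → x ∈ Representation.Coinvariants.ker A.ρ := by
  -- Commutativity is added on top of the given group structure, so that the cohomology groups in
  -- the statement are unchanged.
  let _ : CommGroup G :=
    { (inferInstance : Group G) with
      mul_comm := (IsCyclic.mk ⟨g, hg⟩ : IsCyclic G).commGroup.mul_comm }
  rw [Representation.FiniteCyclicGroup.coinvariantsKer_eq_range A.ρ g hg]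
  have hiff := Rep.FiniteCyclicGroup.groupCohomologyπOdd_eq_zero_iff A g hg 1 odd_one
  constructor
  · intro h x hx
    exact (hiff ⟨x, hx⟩).mp (Subsingleton.elim _ _)
  · intro h
    refine subsingleton_of_forall_eq 0 fun y => ?_
    obtain ⟨x, rfl⟩ := Rep.surjective_groupCohomologyπOdd A g hg 1 odd_one y
    exact (hiff x).mpr (h x.1 x.2)

theorem Representation.coinvariantsTorsionFree_of_forall_subgroup {R G M : Type*} [CommRing R]
    [IsDomain R] [Group G] [Finite G] [AddCommGroup M] [Module R M] {ρ : Representation R G M}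
    {p : ℕ} (hp0 : (p : R) ≠ 0)
    (h : ∀ U : Subgroup G, Module.IsTorsionFree R (Coinvariants (ρ.comp U.subtype)))
    (n : ℕ) (σ : G) : PermutationLattice.CoinvariantsTorsionFree p n (ρ σ) := by
  intro j _ x y hxy
  have hmem : ∀ z, z ∈ Coinvariants.ker (ρ.comp (Subgroup.zpowers (σ ^ p ^ j)).subtype) ↔
      ∃ y, (ρ σ ^ p ^ j) y - y = z := by
    intro z
    rw [FiniteCyclicGroup.coinvariantsKer_eq_range (ρ.comp (Subgroup.zpowers (σ ^ p ^ j)).subtype)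
      ⟨σ ^ p ^ j, Subgroup.mem_zpowers _⟩ (by
        rintro ⟨_, k, rfl⟩
        exact ⟨k, by ext; simp⟩)]
    simp [LinearMap.mem_range]
  have hU := h (Subgroup.zpowers (σ ^ p ^ j))
  have h1 := (Coinvariants.mk_eq_zero _).mpr ((hmem ((p : R) • x)).mpr ⟨y, hxy.symm⟩)
  rw [map_smul] at h1
  obtain ⟨z, hz⟩ := (hmem x).mp
    ((Coinvariants.mk_eq_zero _).mp ((smul_eq_zero.mp h1).resolve_left hp0))
  exact ⟨z, hz.symm⟩

theorem theoremA {R G M : Type u} [CommRing R] [IsDomain R] [IsDiscreteValuationRing R]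
    [CharZero R] (p : ℕ) (hp : p.Prime)
    (hmax : IsLocalRing.maximalIdeal R = Ideal.span {(p : R)})
    [Group G] [Finite G] (hcyc : IsCyclic G) (hG : IsPGroup p G)
    [AddCommGroup M] [Module R M] (ρ : Representation R G M) (hM : ρ.IsLattice) :
    List.TFAE [
      ρ.IsPermutation,
      ∀ U : Subgroup G,
        Subsingleton (groupCohomology (Rep.res U.subtype (Rep.of ρ)) 1),
      ∀ U : Subgroup G,
        Module.IsTorsionFree R (Representation.Coinvariants (ρ.comp U.subtype))] := by
  have := hM.moduleFinite
  have := hM.projective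
  have : Module.Free R M := Module.free_of_flat_of_isLocalRing
  tfae_have 1 → 3 := fun h U => h.isTorsionFree_coinvariants U
  tfae_have 2 ↔ 3 := by
    refine forall_congr' fun U => ?_
    have := Fintype.ofFinite U
    obtain ⟨g, hg⟩ := IsCyclic.exists_generator (α := U)
    rw [Rep.subsingleton_H1_iff_of_forall_mem_zpowers _ g hg,
      Representation.isTorsionFree_coinvariants_iff]
  tfae_have 3 → 1 := by
    intro h
    obtain ⟨σ, hσ⟩ := hcyc.exists_generator
    have := Fact.mk hp
    obtain ⟨n, hn⟩ := IsPGroup.iff_card.mp hG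
    obtain ⟨ι, _, b, hb⟩ := PermutationLattice.exists_basis_forall_apply_mem_range (n := n)
      (T := ρ σ) hp hmax (by rw [← map_pow, ← hn, pow_card_eq_one', map_one])
      (Representation.coinvariantsTorsionFree_of_forall_subgroup
        (by exact_mod_cast hp.ne_zero) h n σ)
    exact Representation.isPermutation_of_basis hσ b hb
  tfae_finish
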